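/- Let $p$ be a prime, let $A=E_9$ be an elementary abelian group of order $9$, let $P=C_p$ be a cyclic group of order $p$, and let $G=A\times P$. A Schur ring (S-ring) over $G$ is a subring $\mathcal A$ of the group ring $\mathbb Z G$ for which there is a partition $\mathcal S(\mathcal A)$ of $G$ (whose classes are called the basic sets) such that $\{1\}\in\mathcal S(\mathcal A)$, $X^{-1}\in\mathcal S(\mathcal A)$ for every $X\in\mathcal S(\mathcal A)$, and $\mathcal A$ is the $\mathbb Z$-span of the elements $\sum_{x\in X}x$, $X\in\mathcal S(\mathcal A)$. Call $\mathcal A$ dense if each of the subgroups $A\times 1$ and $1\times P$ of $G$ is a union of basic sets of $\mathcal A$, and cyclotomic if there is a subgroup $M\le\operatorname{Aut}(G)$ such that $\mathcal S(\mathcal A)$ is exactly the set of orbits of $M$ on $G$. Theorem. Every dense S-ring over $E_9\times C_p$ is cyclotomic. -/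

import Mathlib

/-- The element `∑_{x ∈ X} x` of the integral group ring of a finite group `G`. -/
noncomputable def setSum {G : Type*} [Group G] [Finite G] (X : Set G) : MonoidAlgebra ℤ G :=
  ∑ x ∈ X.toFinite.toFinset, MonoidAlgebra.of ℤ G x

/-- A Schur ring over a finite group `G`: a subring of `ℤG` spanned over `ℤ` by the sums of the
classes of a partition of `G` which is closed under inversion and has `{1}` as a class.
(The partition is recorded along with the subring, which determines it.) -/
structure SchurRing (G : Type*) [Group G] [Finite G] where
  /-- The underlying subring of the group ring. -/
  ring : Subring (MonoidAlgebra ℤ G)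
  /-- The basic sets. -/
  basicSets : Set (Set G)
  isPartition : Setoid.IsPartition basicSets
  one_mem : ({1} : Set G) ∈ basicSets
  inv_mem : ∀ X ∈ basicSets, (Set.image (fun x : G => x⁻¹) X) ∈ basicSets
  ring_eq_span : (ring : Set (MonoidAlgebra ℤ G)) = Submodule.span ℤ (setSum '' basicSets)

namespace SchurRing

variable {G : Type*} [Group G] [Finite G]

/-- A subset of `G` is an `𝒜`-set if it is a union of basic sets. -/
def IsASet (𝒜 : SchurRing G) (Y : Set G) : Prop :=
  ∃ T ⊆ 𝒜.basicSets, Y = ⋃₀ T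

/-- A subgroup of `G` is an `𝒜`-subgroup if its underlying set is an `𝒜`-set. -/
def IsASubgroup (𝒜 : SchurRing G) (H : Subgroup G) : Prop :=
  𝒜.IsASet (H : Set G)

/-- `𝒜` is cyclotomic if its basic sets are exactly the orbits on `G` of some subgroup `M`
of `Aut(G)`. -/
def IsCyclotomic (𝒜 : SchurRing G) : Prop :=
  ∃ M : Subgroup (MulAut G), 𝒜.basicSets = Set.range fun g : G => MulAction.orbit M g

/-- A Schur ring over `A × P` is dense if both direct factors, viewed as the subgroups `A × 1`
and `1 × P`, are `𝒜`-subgroups. -/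
def IsDense {A P : Type*} [Group A] [Group P] [Finite A] [Finite P]
    (𝒜 : SchurRing (A × P)) : Prop :=
  𝒜.IsASubgroup (Subgroup.prod (⊤ : Subgroup A) (⊥ : Subgroup P)) ∧
    𝒜.IsASubgroup (Subgroup.prod (⊥ : Subgroup A) (⊤ : Subgroup P))

end SchurRing

/-!
Write the group as `V × ZMod p` with `V = 𝔽₃²`, and write `x ~ y` when `x` and `y` lie in the same
basic set. It suffices to find, whenever `x ~ y`, an automorphism `e` with `e x = y` and `u ~ e u`
for all `u` (`SchurRing.isCyclotomic_of_forall_rel`).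

*Multipliers.* Every `k ∈ 𝔽_p \ {0}`, acting on the second factor only, permutes the basic sets
(`IsDenseSchurRel.rel_mul_snd`). For `p ≠ 3` this is Schur's theorem on multipliers, applied to a
multiplier which is `1` modulo `3`. For `p = 3` only `k = -1` matters, and the claim follows by
convolving a basic set with the saturated set of nonzero elements of the second factor.

*Slices.* Colour `u ∈ V` by the basic set of `(u, k)`. Fourier inversion over `ZMod p`, together
with the multipliers, isolates single slices of basic sets, and shows that the slices at height `1`
and those at height `k` have the same structure constants whenever some `(d, 1)` is related to some
`(d', k)` (`IsDenseSchurRel.card_slice_eq`). In other words, the slices at height `1` form a Schur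
ring over `V`, and `k` induces an algebraic automorphism of it.

*The plane over `𝔽₃`.* No classification of the Schur rings over `V` is needed. Suppose
`(a, 1) ~ (b, k)` with `a ≠ 0`. By equality of structure constants, the colours of the summands in
the decompositions `a = u + v` are distributed as those in `b = u + v`. Up to sign, `V` consists of
the line `⟨a⟩` and one further coset of it. The colours on that coset form a triangle `α → β → γ`,
negation induces an involution `n` on colours, and the distribution amounts to the multiset of edges
of this triangle and of its reversed image under `n`. That multiset determines the triangle up to
rotation and reversal (`triangle_eq_of_edges_eq`), which is precisely the freedom available in
choosing a linear map with `a ↦ b`; so the colouring at height `1` is carried to that at height `k`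
by an automorphism `σ` of `V` with `σ a = b` (`exists_addEquiv_of_colouring`), and `σ × k` is the
automorphism sought.
-/

/-! ### Basic sets as equivalence classes -/

/-- A set is saturated for an equivalence relation when it is a union of classes. -/
def IsSaturated {α : Type*} (r : Setoid α) (S : Set α) : Prop :=
  ∀ x y, r x y → (x ∈ S ↔ y ∈ S)

theorem isSaturated_setOf_rel {α : Type*} (r : Setoid α) (x : α) : IsSaturated r {y | r y x} :=
  fun _ _ h => ⟨fun h' => r.trans' (r.symm' h) h', fun h' => r.trans' h h'⟩

namespace SchurRing

variable {G : Type*} [Group G] [Finite G]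

/-- The equivalence relation "lying in the same basic set". -/
def rel (𝒜 : SchurRing G) : Setoid G := Setoid.mkClasses 𝒜.basicSets 𝒜.isPartition.2

theorem rel_iff (𝒜 : SchurRing G) {x y : G} :
    𝒜.rel x y ↔ ∃ X ∈ 𝒜.basicSets, x ∈ X ∧ y ∈ X :=
  Setoid.rel_iff_exists_classes _ |>.trans (by
    rw [rel, Setoid.classes_mkClasses _ 𝒜.isPartition])

theorem setOf_rel_mem_basicSets (𝒜 : SchurRing G) (x : G) : {y | 𝒜.rel y x} ∈ 𝒜.basicSets := by
  have := Setoid.mem_classes 𝒜.rel x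
  rwa [rel, Setoid.classes_mkClasses _ 𝒜.isPartition] at this

theorem eq_setOf_rel (𝒜 : SchurRing G) {X : Set G} (hX : X ∈ 𝒜.basicSets) {x : G} (hx : x ∈ X) :
    X = {y | 𝒜.rel y x} :=
  𝒜.isPartition.2 x |>.unique ⟨hX, hx⟩ ⟨𝒜.setOf_rel_mem_basicSets x, 𝒜.rel.refl' x⟩

theorem IsASet.isSaturated {𝒜 : SchurRing G} {S : Set G} (hS : 𝒜.IsASet S) :
    IsSaturated 𝒜.rel S := by
  obtain ⟨T, hT, rfl⟩ := hS
  have key : ∀ x y, 𝒜.rel x y → x ∈ ⋃₀ T → y ∈ ⋃₀ T := by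
    rintro x y hxy ⟨X, hX, hx⟩
    refine ⟨X, hX, ?_⟩
    rw [𝒜.eq_setOf_rel (hT hX) hx]
    exact 𝒜.rel.symm' hxy
  exact fun x y h => ⟨key x y h, key y x (𝒜.rel.symm' h)⟩

theorem rel_inv (𝒜 : SchurRing G) {x y : G} (h : 𝒜.rel x y) : 𝒜.rel x⁻¹ y⁻¹ := by
  obtain ⟨X, hX, hx, hy⟩ := 𝒜.rel_iff.1 h
  exact 𝒜.rel_iff.2 ⟨_, 𝒜.inv_mem X hX, ⟨x, hx, rfl⟩, ⟨y, hy, rfl⟩⟩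

theorem eq_one_of_rel_one (𝒜 : SchurRing G) {x : G} (h : 𝒜.rel 1 x) : x = 1 := by
  have := 𝒜.eq_setOf_rel 𝒜.one_mem (Set.mem_singleton 1)
  have hx : x ∈ ({1} : Set G) := by rw [this]; exact 𝒜.rel.symm' h
  exact hx

/-! ### Elements of the Schur ring -/

open Classical in
theorem coeff_setSum (S : Set G) (g : G) : (setSum S).coeff g = if g ∈ S then 1 else 0 := by
  simp [setSum, MonoidAlgebra.coeff_sum, MonoidAlgebra.coeff_single, Finsupp.single_apply]

/-- The coefficients of `∑ S * ∑ T` count factorisations. -/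
theorem coeff_setSum_mul_setSum (S T : Set G) (d : G) :
    (setSum S * setSum T).coeff d = (Nat.card {u : G // u ∈ S ∧ u⁻¹ * d ∈ T} : ℤ) := by
  classical
  have := Fintype.ofFinite G
  have h : ∀ u v : G, u * v = d ↔ v = u⁻¹ * d := fun u v => by rw [eq_inv_mul_iff_mul_eq]
  rw [setSum, setSum, Finset.sum_mul_sum]
  simp only [MonoidAlgebra.of_apply, MonoidAlgebra.single_mul_single, MonoidAlgebra.coeff_sum,
    Finsupp.finsetSum_apply, MonoidAlgebra.coeff_single, Finsupp.single_apply, h, mul_one,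
    Finset.sum_ite_eq', Set.Finite.mem_toFinset]
  rw [Nat.card_eq_fintype_card, Fintype.card_subtype, Finset.sum_boole]
  congr 2
  ext u
  simp

theorem setSum_mem_ring (𝒜 : SchurRing G) {S : Set G} (hS : IsSaturated 𝒜.rel S) :
    setSum S ∈ 𝒜.ring := by
  classical
  have h : setSum S = ∑ X ∈ (Set.toFinite {X ∈ 𝒜.basicSets | X ⊆ S}).toFinset, setSum X := by
    ext g
    simp only [MonoidAlgebra.coeff_sum, Finsupp.finsetSum_apply, coeff_setSum]
    have hg : g ∈ {y | 𝒜.rel y g} := 𝒜.rel.refl' g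
    by_cases hgS : g ∈ S
    · rw [if_pos hgS, Finset.sum_eq_single {y | 𝒜.rel y g}, if_pos hg]
      · intro X hX hne
        refine if_neg fun hgX => hne (𝒜.eq_setOf_rel ?_ hgX)
        exact ((Set.Finite.mem_toFinset _).1 hX).1
      · intro hX
        have hmem : {y | 𝒜.rel y g} ∈ {X ∈ 𝒜.basicSets | X ⊆ S} :=
          ⟨𝒜.setOf_rel_mem_basicSets g, fun y hy => (hS y g hy).2 hgS⟩
        exact absurd ((Set.Finite.mem_toFinset _).2 hmem) hX
    · rw [if_neg hgS, Finset.sum_eq_zero]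
      intro X hX
      exact if_neg fun hgX => hgS (((Set.Finite.mem_toFinset _).1 hX).2 hgX)
  rw [h]
  refine sum_mem fun X hX => ?_
  rw [← SetLike.mem_coe, 𝒜.ring_eq_span]
  exact Submodule.subset_span ⟨X, ((Set.Finite.mem_toFinset _).1 hX).1, rfl⟩

theorem coeff_eq_of_mem_ring (𝒜 : SchurRing G) {u : MonoidAlgebra ℤ G} (hu : u ∈ 𝒜.ring)
    {x y : G} (h : 𝒜.rel x y) : u.coeff x = u.coeff y := by
  classical
  have hu' : u ∈ Submodule.span ℤ (setSum '' 𝒜.basicSets) := by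
    rw [← SetLike.mem_coe, ← 𝒜.ring_eq_span]; exact hu
  clear hu
  induction hu' using Submodule.span_induction with
  | mem v hv =>
    obtain ⟨X, hX, rfl⟩ := hv
    have hX' : 𝒜.IsASet X := ⟨{X}, by simpa using hX, by simp⟩
    simp only [coeff_setSum, hX'.isSaturated x y h]
  | zero => rfl
  | add v w hv hw h1 h2 => simp [h1, h2]
  | smul n v hv h1 => simp only [MonoidAlgebra.coeff_smul, Finsupp.smul_apply, h1]

/-- **Schur's multiplier theorem**, for a prime multiplier `q`: modulo `q`, the `q`-th power of
`∑ X` is the sum of the set of `q`-th powers of elements of `X`. -/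
theorem rel_of_rel_pow_prime {G : Type*} [CommGroup G] [Finite G] (𝒜 : SchurRing G) {q : ℕ}
    (hq : q.Prime) (hqG : ¬ q ∣ Nat.card G) {x y : G} (h : 𝒜.rel (x ^ q) (y ^ q)) :
    𝒜.rel x y := by
  classical
  have : Fact q.Prime := ⟨hq⟩
  have hinj : Function.Injective (fun g : G => g ^ q) :=
    (powCoprime ((Nat.coprime_comm.1 (hq.coprime_iff_not_dvd.2 hqG)))).injective
  set X : Set G := {z | 𝒜.rel z y} with hXdef
  have hc := 𝒜.coeff_eq_of_mem_ring
    (𝒜.ring.pow_mem (𝒜.setSum_mem_ring (isSaturated_setOf_rel 𝒜.rel y)) q) h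
  have key : ∀ g : G, (((setSum X ^ q).coeff (g ^ q) : ℤ) : ZMod q) = if g ∈ X then 1 else 0 := by
    intro g
    have e1 : (((setSum X ^ q).coeff (g ^ q) : ℤ) : ZMod q) =
        (MonoidAlgebra.mapRingHom G (Int.castRingHom (ZMod q)) (setSum X ^ q)).coeff (g ^ q) := by
      simp only [MonoidAlgebra.coeff_mapRingHom]
      rfl
    have : CharP (MonoidAlgebra (ZMod q) G) q :=
      charP_of_injective_algebraMap (R := ZMod q) (RingHom.injective _) q
    rw [e1, map_pow (MonoidAlgebra.mapRingHom _ _), setSum, map_sum, sum_pow_char q]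
    simp [MonoidAlgebra.coeff_sum, MonoidAlgebra.single_pow, Finsupp.single_apply, hinj.eq_iff]
  have h2 := congrArg (Int.cast : ℤ → ZMod q) hc
  rw [key, key, if_pos (show y ∈ X from 𝒜.rel.refl' y)] at h2
  by_contra hx
  rw [if_neg (show x ∉ X from hx)] at h2
  exact zero_ne_one h2

end SchurRing

/-! ### Schur relations on additive groups -/

/-- The properties of the relation "lying in the same basic set" of a Schur ring over a finite
abelian group, written additively, that are used below. -/
structure IsSchurRel {W : Type*} [AddCommGroup W] (r : Setoid W) : Prop where
  eq_zero : ∀ x, r 0 x → x = 0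
  neg : ∀ x y, r x y → r (-x) (-y)
  card_eq : ∀ S T : Set W, IsSaturated r S → IsSaturated r T → ∀ d d', r d d' →
    Nat.card {u // u ∈ S ∧ d - u ∈ T} = Nat.card {u // u ∈ S ∧ d' - u ∈ T}
  of_prime_nsmul : ∀ q : ℕ, q.Prime → ¬ q ∣ Nat.card W → ∀ x y, r (q • x) (q • y) → r x y

/-- A Schur relation on a product for which both factors are saturated. -/
structure IsDenseSchurRel {V Q : Type*} [AddCommGroup V] [AddCommGroup Q]
    (r : Setoid (V × Q)) : Prop extends IsSchurRel r where
  left : IsSaturated r {x | x.2 = 0}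
  right : IsSaturated r {x | x.1 = 0}

namespace IsSchurRel

variable {W : Type*} [AddCommGroup W] [Finite W] {r : Setoid W}

theorem exists_of_rel (hr : IsSchurRel r) {S T : Set W} (hS : IsSaturated r S)
    (hT : IsSaturated r T) {d d' u : W} (h : r d d') (hu : u ∈ S) (hdu : d - u ∈ T) :
    ∃ u' ∈ S, d' - u' ∈ T := by
  have hc := hr.card_eq S T hS hT d d' h
  have : Nonempty {u // u ∈ S ∧ d - u ∈ T} := ⟨⟨u, hu, hdu⟩⟩
  have hpos : 0 < Nat.card {u // u ∈ S ∧ d' - u ∈ T} := hc ▸ Nat.card_pos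
  obtain ⟨⟨u', h1, h2⟩⟩ := (Nat.card_pos_iff.1 hpos).1
  exact ⟨u', h1, h2⟩

theorem of_nsmul (hr : IsSchurRel r) (m : ℕ) (hm : m.Coprime (Nat.card W)) (x y : W)
    (h : r (m • x) (m • y)) : r x y := by
  induction m using induction_on_primes generalizing x y with
  | zero =>
    have : Subsingleton W := Finite.card_le_one_iff_subsingleton.1 (by simp at hm; omega)
    rw [Subsingleton.elim x y]
  | one => simpa using h
  | prime_mul q a hq ih =>
    rw [mul_nsmul, mul_nsmul] at h
    refine hr.of_prime_nsmul q hq ?_ _ _ (ih (Nat.Coprime.coprime_mul_left hm) _ _ h)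
    exact (hq.coprime_iff_not_dvd).1 (Nat.Coprime.coprime_mul_right hm)

end IsSchurRel

/-! ### Dense Schur relations -/

theorem ZMod.eq_one_or_eq_neg_one_of_three : ∀ {k : ZMod 3}, k ≠ 0 → k = 1 ∨ k = -1 := by
  decide

namespace IsDenseSchurRel

section

variable {V Q : Type*} [AddCommGroup V] [AddCommGroup Q] {r : Setoid (V × Q)}

theorem snd_eq_zero_iff (hr : IsDenseSchurRel r) {a b : V} {z w : Q} (h : r (a, z) (b, w)) :
    z = 0 ↔ w = 0 := hr.left _ _ h

theorem fst_eq_zero_iff (hr : IsDenseSchurRel r) {a b : V} {z w : Q} (h : r (a, z) (b, w)) :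
    a = 0 ↔ b = 0 := hr.right _ _ h

variable [Finite V] [Finite Q]

/-- Basic sets project onto basic sets of the first factor. -/
theorem rel_fst (hr : IsDenseSchurRel r) {a b : V} {z w : Q} (h : r (a, z) (b, w)) :
    r (a, 0) (b, 0) := by
  obtain ⟨⟨u, t⟩, h1, h2⟩ := hr.exists_of_rel (isSaturated_setOf_rel r (a, 0)) hr.right h
    (u := (a, 0)) (r.refl' _) (by simp)
  obtain rfl : b = u := by simpa [sub_eq_zero] using h2
  obtain rfl : t = 0 := (hr.snd_eq_zero_iff h1).2 rfl
  exact r.symm' h1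

/-- Basic sets project onto basic sets of the second factor. -/
theorem rel_snd (hr : IsDenseSchurRel r) {a b : V} {z w : Q} (h : r (a, z) (b, w)) :
    r (0, z) (0, w) := by
  obtain ⟨⟨u, t⟩, h1, h2⟩ := hr.exists_of_rel (isSaturated_setOf_rel r (0, z)) hr.left h
    (u := (0, z)) (r.refl' _) (by simp)
  obtain rfl : w = t := by simpa [sub_eq_zero] using h2
  obtain rfl : u = 0 := (hr.fst_eq_zero_iff h1).2 rfl
  exact r.symm' h1

theorem exists_rel_of_rel_fst (hr : IsDenseSchurRel r) {a b : V} (z : Q) (h : r (a, 0) (b, 0)) :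
    ∃ w, r (a, z) (b, w) := by
  obtain ⟨⟨u, t⟩, h1, h2⟩ := hr.exists_of_rel (isSaturated_setOf_rel r (a, z)) hr.right h
    (u := (a, z)) (r.refl' _) (by simp)
  obtain rfl : b = u := by simpa [sub_eq_zero] using h2
  exact ⟨t, r.symm' h1⟩

theorem exists_rel_of_rel_snd (hr : IsDenseSchurRel r) (a : V) {z w : Q} (h : r (0, z) (0, w)) :
    ∃ b, r (a, z) (b, w) := by
  obtain ⟨⟨u, t⟩, h1, h2⟩ := hr.exists_of_rel (isSaturated_setOf_rel r (a, z)) hr.left h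
    (u := (a, z)) (r.refl' _) (by simp)
  obtain rfl : w = t := by simpa [sub_eq_zero] using h2
  exact ⟨u, r.symm' h1⟩

end

section

variable {V : Type*} [AddCommGroup V] [Finite V] {p : ℕ} [Fact p.Prime]
  {r : Setoid (V × ZMod p)}

/-- For `p = 3`, a basic set is carried to a basic set by inversion of the second coordinate: this
comes from convolving with the set of nonzero elements of the second factor. -/
theorem rel_neg_snd {r : Setoid (V × ZMod 3)} (hr : IsDenseSchurRel r) {a b : V} {z w : ZMod 3}
    (h : r (a, z) (b, w)) : r (a, -z) (b, -w) := by
  by_cases hz : z = 0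
  · obtain rfl : w = 0 := (hr.snd_eq_zero_iff h).1 hz
    simpa [hz] using h
  have hw : w ≠ 0 := fun hw => hz ((hr.snd_eq_zero_iff h).2 hw)
  have hS : IsSaturated r {x : V × ZMod 3 | x.1 = 0 ∧ x.2 ≠ 0} := fun x y hxy =>
    and_congr (hr.right x y hxy) (not_congr (hr.left x y hxy))
  obtain ⟨⟨u, t⟩, ⟨h1, h2⟩, h3⟩ := hr.exists_of_rel hS (isSaturated_setOf_rel r (a, -z)) h
    (u := (0, -z)) ⟨rfl, by simpa using hz⟩ (by
      have : z - -z = -z := (by decide : ∀ z : ZMod 3, z - -z = -z) z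
      simp [this])
  obtain rfl : u = 0 := h1
  simp only [Set.mem_ofPred_eq, Prod.mk_sub_mk, sub_zero] at h3
  have hwt : w - t ≠ 0 := fun h0 => hz (neg_eq_zero.1 ((hr.snd_eq_zero_iff h3).1 h0))
  have : w - t = -w := 
    (by decide : ∀ w t : ZMod 3, w ≠ 0 → t ≠ 0 → w - t ≠ 0 → w - t = -w) w t hw h2 hwt
  exact r.symm' (this ▸ h3)

/-- The group of units of `ZMod p`, acting on the second coordinate, permutes the basic sets. -/
theorem rel_mul_snd (hr : IsDenseSchurRel r) (hV : Nat.card V = 9) (hV3 : ∀ a : V, 3 • a = 0)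
    {k : ZMod p} (hk : k ≠ 0) {a b : V} {z w : ZMod p} (h : r (a, z) (b, w)) :
    r (a, k * z) (b, k * w) := by
  have hp : p.Prime := Fact.out
  by_cases hp3 : p = 3
  · subst hp3
    have : k = 1 ∨ k = -1 := ZMod.eq_one_or_eq_neg_one_of_three hk
    obtain rfl | rfl := this
    · simpa using h
    · simpa using hr.rel_neg_snd h
  have hcop : Nat.Coprime 3 p := (Nat.coprime_primes Nat.prime_three hp).2 (Ne.symm hp3)
  -- a multiplier acting trivially on the first factor and as `k⁻¹` on the second
  obtain ⟨m, hm3, hmp⟩ := Nat.chineseRemainder hcop 1 (k⁻¹).val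
  have hmk : (m : ZMod p) = k⁻¹ := by
    rw [(ZMod.natCast_eq_natCast_iff _ _ _).2 hmp, ZMod.natCast_zmod_val]
  have hma : ∀ a : V, m • a = a := fun a => by
    have h1 : m = m / 3 * 3 + 1 := by
      have := Nat.div_add_mod m 3
      have h2 : m % 3 = 1 := hm3
      omega
    rw [h1, add_nsmul, mul_nsmul', hV3, nsmul_zero, zero_add, one_nsmul]
  have hmc : m.Coprime (Nat.card (V × ZMod p)) := by
    rw [Nat.card_prod, hV, Nat.card_zmod]
    refine Nat.Coprime.mul_right ?_ ?_
    · rw [show 9 = 3 ^ 2 by norm_num]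
      refine Nat.Coprime.pow_right _ ?_
      rw [Nat.Coprime, Nat.ModEq.gcd_eq hm3, Nat.gcd_one_left]
    · exact (ZMod.isUnit_iff_coprime m p).1 (hmk ▸ (inv_ne_zero hk).isUnit)
  refine hr.of_nsmul m hmc _ _ ?_
  simpa [Prod.smul_mk, hma, hmk, hk] using h

end

end IsDenseSchurRel

/-! ### Structure constants of slices -/

namespace IsDenseSchurRel

variable {V : Type*} [AddCommGroup V] {p : ℕ} [Fact p.Prime]
  {r : Setoid (V × ZMod p)}

open Classical in
/-- Fourier inversion on the second factor: a combination of the basic sets of the elements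
`(a, i)` isolates the slice at height `k` of the basic set of `(a, 1)`. -/
theorem sum_stdAddChar_indicator (hr : IsDenseSchurRel r)
    (hmul : ∀ k : ZMod p, k ≠ 0 → ∀ (a b : V) (z w : ZMod p), r (a, z) (b, w) →
      r (a, k * z) (b, k * w)) (k : ZMod p) (a u : V) :
    ∑ i : ZMod p, ∑ s : ZMod p, (ZMod.stdAddChar (-i) - 1 : ℂ) *
      (ZMod.stdAddChar s * if r (u, k * s) (a, i) then 1 else 0) =
      p * if r (u, k) (a, 1) then 1 else 0 := by
  -- the basic set of `(a, i)` is that of `(a, 1)` with heights multiplied by `i`; both sides vanish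
  -- for `i = 0`
  have hscale : ∀ i : ZMod p, ∑ s : ZMod p, (ZMod.stdAddChar (-i) - 1 : ℂ) *
      (ZMod.stdAddChar s * if r (u, k * s) (a, i) then 1 else 0) =
      ∑ t : ZMod p, (ZMod.stdAddChar (i * (t - 1)) - ZMod.stdAddChar (i * t) : ℂ) *
        if r (u, k * t) (a, 1) then 1 else 0 := by
    intro i
    by_cases hi : i = 0
    · simp [hi]
    refine (Fintype.sum_equiv (Equiv.mulLeft₀ i hi) _ _ fun t => ?_).symm
    have hiff : r (u, k * (i * t)) (a, i) ↔ r (u, k * t) (a, 1) := by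
      constructor
      · intro h
        have := hmul i⁻¹ (inv_ne_zero hi) _ _ _ _ h
        rwa [inv_mul_cancel₀ hi, show i⁻¹ * (k * (i * t)) = k * t by field_simp] at this
      · intro h
        have := hmul i hi _ _ _ _ h
        rwa [mul_one, show i * (k * t) = k * (i * t) by ring] at this
    have happ : Equiv.mulLeft₀ i hi t = i * t := rfl
    simp only [happ, hiff]
    rw [← mul_assoc, sub_mul _ _ (ZMod.stdAddChar (i * t)), ← AddChar.map_add_eq_mul, one_mul,
      show -i + i * t = i * (t - 1) by ring]
  have horth : ∀ b : ZMod p, ∑ i : ZMod p, (ZMod.stdAddChar (i * b) : ℂ) =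
      if b = 0 then (p : ℂ) else 0 := by
    intro b
    rw [AddChar.sum_mulShift b (ZMod.isPrimitive_stdAddChar p), ZMod.card]
    split_ifs <;> simp
  simp_rw [hscale]
  rw [Finset.sum_comm]
  simp_rw [← Finset.sum_mul, Finset.sum_sub_distrib, horth]
  have hzero : ¬ r (u, 0) (a, 1) := fun h =>
    one_ne_zero ((hr.snd_eq_zero_iff h).1 rfl)
  rw [Finset.sum_eq_single 1]
  · simp
  · intro t _ ht
    by_cases ht0 : t = 0
    · simp [ht0, hzero]
    · simp [ht0, sub_eq_zero, ht]
  · simp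

variable [Fintype V]

open Classical in
/-- The number of factorisations between two slices at height `k`, as a combination of structure
constants of the Schur relation taken along the line `{d} × k 𝔽_p`. The sum over `z` turns
convolution on the second factor into a product of the two sums of `sum_stdAddChar_indicator`. -/
theorem sum_sum_stdAddChar_card (hr : IsDenseSchurRel r)
    (hmul : ∀ k : ZMod p, k ≠ 0 → ∀ (a b : V) (z w : ZMod p), r (a, z) (b, w) →
      r (a, k * z) (b, k * w)) {k : ZMod p} (hk : k ≠ 0) (a b d : V) :
    ∑ i : ZMod p, ∑ j : ZMod p, (ZMod.stdAddChar (-i) - 1 : ℂ) * (ZMod.stdAddChar (-j) - 1) *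
      ∑ z : ZMod p, ZMod.stdAddChar z * (Nat.card {x : V × ZMod p //
        x ∈ {y | r y (a, i)} ∧ (d, k * z) - x ∈ {y | r y (b, j)}} : ℂ) =
      p ^ 2 * (Nat.card {u : V // r (u, k) (a, 1) ∧ r (d - u, k) (b, 1)} : ℂ) := by
  have hcard : ∀ i j z : ZMod p, (Nat.card {x : V × ZMod p //
        x ∈ {y | r y (a, i)} ∧ (d, k * z) - x ∈ {y | r y (b, j)}} : ℂ) =
      ∑ u : V, ∑ s : ZMod p, (if r (u, k * s) (a, i) then 1 else 0) *
        (if r (d - u, k * (z - s)) (b, j) then 1 else 0) := by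
    intro i j z
    rw [Nat.card_eq_fintype_card, Fintype.card_subtype, ← Finset.sum_boole,
      Fintype.sum_prod_type]
    refine Finset.sum_congr rfl fun u _ => ?_
    refine (Fintype.sum_equiv (Equiv.mulLeft₀ k hk) _ _ fun s => ?_).symm
    have happ : Equiv.mulLeft₀ k hk s = k * s := rfl
    simp only [happ, Set.mem_ofPred_eq, Prod.mk_sub_mk, mul_sub, ← ite_and, mul_ite, mul_one,
      mul_zero, and_comm]
  have hconv : ∀ i j : ZMod p, ∑ z : ZMod p, ZMod.stdAddChar z * (Nat.card {x : V × ZMod p //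
        x ∈ {y | r y (a, i)} ∧ (d, k * z) - x ∈ {y | r y (b, j)}} : ℂ) =
      ∑ u : V, (∑ s : ZMod p, ZMod.stdAddChar s * if r (u, k * s) (a, i) then 1 else 0) *
        ∑ t : ZMod p, ZMod.stdAddChar t * if r (d - u, k * t) (b, j) then 1 else 0 := by
    intro i j
    simp_rw [hcard, Finset.mul_sum]
    rw [Finset.sum_comm]
    refine Finset.sum_congr rfl fun u _ => ?_
    rw [Finset.sum_comm]
    simp_rw [Finset.sum_mul]
    conv_rhs => rw [Finset.sum_comm]
    refine Finset.sum_congr rfl fun s _ => ?_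
    refine (Fintype.sum_equiv (Equiv.addRight s) _ _ fun t => ?_).symm
    simp only [Equiv.coe_addRight, add_sub_cancel_right, AddChar.map_add_eq_mul]
    ring
  simp_rw [hconv]
  have hexp : ∀ (c : ZMod p → ℂ) (f g : ZMod p → V → ℂ),
      ∑ i, ∑ j, c i * c j * ∑ u, f i u * g j u =
        ∑ u, (∑ i, c i * f i u) * ∑ j, c j * g j u := by
    intro c f g
    simp_rw [Finset.sum_mul_sum]
    rw [Finset.sum_comm (s := (Finset.univ : Finset V))]
    refine Finset.sum_congr rfl fun i _ => ?_
    rw [Finset.sum_comm (s := (Finset.univ : Finset V))]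
    refine Finset.sum_congr rfl fun j _ => ?_
    rw [Finset.mul_sum]
    exact Finset.sum_congr rfl fun u _ => by ring
  calc _ = ∑ u : V,
        (∑ i : ZMod p, ∑ s : ZMod p, (ZMod.stdAddChar (-i) - 1 : ℂ) *
          (ZMod.stdAddChar s * if r (u, k * s) (a, i) then 1 else 0)) *
        (∑ j : ZMod p, ∑ t : ZMod p, (ZMod.stdAddChar (-j) - 1 : ℂ) *
          (ZMod.stdAddChar t * if r (d - u, k * t) (b, j) then 1 else 0)) := by
        simp_rw [← Finset.mul_sum]
        exact hexp _ _ _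
    _ = ∑ u : V, ((p : ℂ) * if r (u, k) (a, 1) then 1 else 0) *
          ((p : ℂ) * if r (d - u, k) (b, 1) then 1 else 0) := by
        simp_rw [hr.sum_stdAddChar_indicator hmul]
    _ = _ := by
        rw [Nat.card_eq_fintype_card, Fintype.card_subtype, ← Finset.sum_boole, Finset.mul_sum]
        refine Finset.sum_congr rfl fun u _ => ?_
        by_cases h1 : r (u, k) (a, 1) <;> by_cases h2 : r (d - u, k) (b, 1) <;>
          simp [h1, h2, pow_two]

/-- The slices at height `1` of the basic sets multiply with the same structure constants as the
slices at height `k`. -/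
theorem card_slice_eq (hr : IsDenseSchurRel r)
    (hmul : ∀ k : ZMod p, k ≠ 0 → ∀ (a b : V) (z w : ZMod p), r (a, z) (b, w) →
      r (a, k * z) (b, k * w)) {k : ZMod p} {d d' : V} (h : r (d, 1) (d', k)) (a b : V) :
    Nat.card {u : V // r (u, 1) (a, 1) ∧ r (d - u, 1) (b, 1)} =
      Nat.card {u : V // r (u, k) (a, 1) ∧ r (d' - u, k) (b, 1)} := by
  have hk : k ≠ 0 := fun hk => one_ne_zero ((hr.snd_eq_zero_iff h).2 hk)
  -- the two combinations of `sum_sum_stdAddChar_card` agree term by term, since `(d, z)` and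
  -- `(d', k z)` are always related
  have hline : ∀ z : ZMod p, r (d, 1 * z) (d', k * z) := by
    intro z
    by_cases hz : z = 0
    · simpa [hz] using hr.rel_fst h
    · simpa [mul_comm] using hmul z hz _ _ _ _ h
  have h1 := hr.sum_sum_stdAddChar_card hmul one_ne_zero a b d
  have h2 := hr.sum_sum_stdAddChar_card hmul hk a b d'
  have hp : (p : ℂ) ^ 2 ≠ 0 := pow_ne_zero _ (Nat.cast_ne_zero.2 (NeZero.ne p))
  have h3 := h1.symm.trans (Eq.trans ?_ h2)
  · exact_mod_cast mul_left_cancel₀ hp h3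
  refine Finset.sum_congr rfl fun i _ => Finset.sum_congr rfl fun j _ => ?_
  congr 1
  refine Finset.sum_congr rfl fun z _ => ?_
  rw [hr.card_eq _ _ (isSaturated_setOf_rel r _) (isSaturated_setOf_rel r _) _ _ (hline z)]

end IsDenseSchurRel

/-! ### Directed triangles with an involution -/

section Triangles

variable {ι : Type*}

/-- The six edges of the directed triangle `α → β → γ → α` and of its image under reversal of
edges combined with the involution `n`. -/
def triangleEdges (n : ι → ι) (α β γ : ι) : Multiset (ι × ι) :=
  {(α, β)} + {(β, γ)} + {(γ, α)} + {(n β, n α)} + {(n γ, n β)} + {(n α, n γ)}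

theorem triangleEdges_rotate (n : ι → ι) (α β γ : ι) :
    triangleEdges n β γ α = triangleEdges n α β γ := by
  simp only [triangleEdges]; abel

theorem triangleEdges_reverse {n : ι → ι} (hn : ∀ i, n (n i) = i) (α β γ : ι) :
    triangleEdges n (n β) (n α) (n γ) = triangleEdges n α β γ := by
  simp only [triangleEdges, hn]; abel

/-- The three ways in which triangles with a common first edge `(α, β)` can have the same edges; in
the last two they differ by a reversal and a rotation. -/
theorem triangle_eq_of_edges_eq_of_first {n : ι → ι} (hn : ∀ i, n (n i) = i) {α β γ γ' : ι}
    (h : triangleEdges n α β γ = triangleEdges n α β γ') :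
    γ' = γ ∨ (α = γ ∧ β = γ' ∧ α = n β) ∨ (β = n α ∧ γ' = n γ) := by
  have h4 : ({(β, γ)} + ({(γ, α)} + {(n γ, n β)} + {(n α, n γ)}) : Multiset (ι × ι)) =
      {(β, γ')} + {(γ', α)} + {(n γ', n β)} + {(n α, n γ')} := by
    apply add_left_cancel (a := ({(α, β)} + {(n β, n α)} : Multiset (ι × ι)))
    have : ∀ δ : ι, triangleEdges n α β δ = {(α, β)} + {(n β, n α)} +
        ({(β, δ)} + {(δ, α)} + {(n δ, n β)} + {(n α, n δ)}) := fun δ => by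
      simp only [triangleEdges]; abel
    rw [this, this] at h
    simpa only [add_assoc] using h
  have hmem : (β, γ) ∈ ({(β, γ')} + {(γ', α)} + {(n γ', n β)} + {(n α, n γ')} :
      Multiset (ι × ι)) := h4 ▸ by simp
  simp only [Multiset.mem_add, Multiset.mem_singleton, Prod.mk.injEq] at hmem
  obtain ((⟨-, h1⟩ | ⟨h1, h2⟩) | ⟨h1, h2⟩) | ⟨h1, h2⟩ := hmem
  · exact Or.inl h1.symm
  · subst h1 h2
    have h2 : ({(γ, γ)} + {(n γ, n γ)} : Multiset (ι × ι)) = {(β, β)} + {(n β, n β)} := by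
      apply add_left_cancel (a := ({(β, γ)} + {(n γ, n β)} : Multiset (ι × ι)))
      calc _ = _ := by abel
        _ = _ := h4
        _ = _ := by abel
    have hmem : (γ, γ) ∈ ({(β, β)} + {(n β, n β)} : Multiset (ι × ι)) := h2 ▸ by simp
    simp only [Multiset.mem_add, Multiset.mem_singleton, Prod.mk.injEq, and_self] at hmem
    obtain h3 | h3 := hmem
    · exact Or.inl h3.symm
    · exact Or.inr (Or.inl ⟨rfl, rfl, h3⟩)
  · left; rw [h2, h1, hn]
  · right; right; exact ⟨h1, by rw [h2, hn]⟩

/-- The multiset of edges determines the triangle up to rotation and reversal with `n`: those six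
symmetries permute the edges transitively, so a common edge may be moved to the first place. -/
theorem triangle_eq_of_edges_eq {n : ι → ι} (hn : ∀ i, n (n i) = i) {α β γ α' β' γ' : ι}
    (h : triangleEdges n α β γ = triangleEdges n α' β' γ') :
    (α' = α ∧ β' = β ∧ γ' = γ) ∨ (α' = β ∧ β' = γ ∧ γ' = α) ∨ (α' = γ ∧ β' = α ∧ γ' = β) ∨
    (α' = n β ∧ β' = n α ∧ γ' = n γ) ∨ (α' = n γ ∧ β' = n β ∧ γ' = n α) ∨
    (α' = n α ∧ β' = n γ ∧ γ' = n β) := by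
  have hmem : (α, β) ∈ triangleEdges n α' β' γ' := h ▸ by simp [triangleEdges]
  simp only [triangleEdges, Multiset.mem_add, Multiset.mem_singleton, Prod.mk.injEq] at hmem
  obtain (((((⟨h1, h2⟩ | ⟨h1, h2⟩) | ⟨h1, h2⟩) | ⟨h1, h2⟩) | ⟨h1, h2⟩) | ⟨h1, h2⟩) := hmem
  · subst h1 h2
    have := triangle_eq_of_edges_eq_of_first hn h
    grind
  · rw [← triangleEdges_rotate n α' β' γ', ← h1, ← h2] at h
    have := triangle_eq_of_edges_eq_of_first hn h
    grind
  · rw [← triangleEdges_rotate n α' β' γ', ← triangleEdges_rotate n β' γ' α', ← h1, ← h2] at h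
    have := triangle_eq_of_edges_eq_of_first hn h
    grind
  · rw [← triangleEdges_reverse hn α' β' γ', ← h1, ← h2] at h
    have := triangle_eq_of_edges_eq_of_first hn h
    grind
  · rw [← triangleEdges_rotate n α' β' γ', ← triangleEdges_reverse hn β' γ' α', ← h1, ← h2] at h
    have := triangle_eq_of_edges_eq_of_first hn h
    grind
  · rw [← triangleEdges_rotate n α' β' γ', ← triangleEdges_rotate n β' γ' α',
      ← triangleEdges_reverse hn γ' α' β', ← h1, ← h2] at h
    have := triangle_eq_of_edges_eq_of_first hn h
    grind

end Triangles

/-! ### Colourings of the plane over `𝔽₃` -/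

section Plane

/-- The shear or shear-reflection `(i, j) ↦ (i + s j, ε j)` of the plane over `𝔽₃`. -/
def shear (s ε : ZMod 3) (hε : ε * ε = 1) : ZMod 3 × ZMod 3 ≃+ ZMod 3 × ZMod 3 where
  toFun x := (x.1 + s * x.2, ε * x.2)
  invFun x := (x.1 - s * ε * x.2, ε * x.2)
  left_inv x := by
    ext
    · linear_combination (-s * x.2) * hε
    · linear_combination x.2 * hε
  right_inv x := by
    ext
    · ring
    · linear_combination x.2 * hε
  map_add' x y := by ext <;> simp <;> ring

theorem exists_addEquiv_apply_one_zero {a : ZMod 3 × ZMod 3} (ha : a ≠ 0) :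
    ∃ e : ZMod 3 × ZMod 3 ≃+ ZMod 3 × ZMod 3, e (1, 0) = a := by
  obtain ⟨x, y⟩ := a
  have key : ∀ x y : ZMod 3, (x, y) ≠ 0 → ∃ z w, x * w - y * z = 1 := by decide
  obtain ⟨z, w, h⟩ := key x y ha
  refine ⟨⟨⟨fun u => (x * u.1 + z * u.2, y * u.1 + w * u.2),
    fun u => (w * u.1 - z * u.2, x * u.2 - y * u.1), fun u => ?_, fun u => ?_⟩, fun u v => ?_⟩, ?_⟩
  · ext
    · linear_combination u.1 * h
    · linear_combination u.2 * h
  · ext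
    · linear_combination u.1 * h
    · linear_combination u.2 * h
  · ext <;> simp <;> ring
  · simp

variable {ι : Type*}

/-- The case `a = b = (1, 0)` of `exists_addEquiv_of_colouring`. A line of direction `(1, 0)` off
the origin is a triangle under translation by `(1, 0)`, and negation gives the opposite line, so
the hypothesis `H` compares two values of `triangleEdges`. -/
theorem exists_addEquiv_of_colouring_one_zero {n : ι → ι} (hn : ∀ i, n (n i) = i)
    {c c' : ZMod 3 × ZMod 3 → ι} (hc : ∀ x, c (-x) = n (c x)) (hc' : ∀ x, c' (-x) = n (c' x))
    (h0 : c 0 = c' 0) (h1 : c (1, 0) = c' (1, 0))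
    (H : Finset.univ.val.map (fun u => (c u, c ((1, 0) - u))) =
      Finset.univ.val.map (fun u => (c' u, c' ((1, 0) - u)))) :
    ∃ σ : ZMod 3 × ZMod 3 ≃+ ZMod 3 × ZMod 3, σ (1, 0) = (1, 0) ∧ ∀ x, c' (σ x) = c x := by
  have key : ∀ c : ZMod 3 × ZMod 3 → ι, (∀ x, c (-x) = n (c x)) →
      (Finset.univ.val.map (fun u => (c u, c ((1, 0) - u)))).map (Prod.map id n) =
        ({(c 0, n (c (1, 0)))} + {(c (1, 0), n (c 0))} + {(n (c (1, 0)), c (1, 0))}) +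
          triangleEdges n (c (0, 1)) (c (2, 1)) (c (1, 1)) := by
    intro c hc
    have e20 : c (2, 0) = n (c (1, 0)) := hc (1, 0)
    have e02 : c (0, 2) = n (c (0, 1)) := hc (0, 1)
    have e12 : c (1, 2) = n (c (2, 1)) := hc (2, 1)
    have e22 : c (2, 2) = n (c (1, 1)) := hc (1, 1)
    have : Finset.univ.val.map (fun u => (c u, c ((1, 0) - u))) =
      {(c 0, c (1, 0))} + {(c (0, 1), c (1, 2))} + {(c (0, 2), c (1, 1))} +
      {(c (1, 0), c 0)} + {(c (1, 1), c (0, 2))} + {(c (1, 2), c (0, 1))} +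
      {(c (2, 0), c (2, 0))} + {(c (2, 1), c (2, 2))} + {(c (2, 2), c (2, 1))} := rfl
    rw [this, triangleEdges]
    simp only [Multiset.map_add, Multiset.map_singleton, Prod.map, id, e20, e02, e12, e22, hn]
    abel
  have hH := congrArg (Multiset.map (Prod.map id n)) H
  rw [key c hc, key c' hc', h0, h1] at hH
  -- the pairs supported on the line through the origin cancel
  have htri := triangle_eq_of_edges_eq hn (add_left_cancel hH)
  -- it suffices to match the colours on the line of height one
  have hfin : ∀ σ : ZMod 3 × ZMod 3 ≃+ ZMod 3 × ZMod 3, σ (1, 0) = (1, 0) →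
      c' (σ (0, 1)) = c (0, 1) → c' (σ (1, 1)) = c (1, 1) → c' (σ (2, 1)) = c (2, 1) →
      ∃ σ : ZMod 3 × ZMod 3 ≃+ ZMod 3 × ZMod 3, σ (1, 0) = (1, 0) ∧ ∀ x, c' (σ x) = c x := by
    intro σ hσ g0 g1 g2
    refine ⟨σ, hσ, ?_⟩
    have hneg : ∀ x, c' (σ x) = c x → c' (σ (-x)) = c (-x) := fun x hx => by
      rw [map_neg, hc', hx, hc]
    have g10 : c' (σ (1, 0)) = c (1, 0) := by rw [hσ, h1]
    have hcases : ∀ x : ZMod 3 × ZMod 3, x = 0 ∨ x = (1, 0) ∨ x = -(1, 0) ∨ x = (0, 1) ∨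
      x = (1, 1) ∨ x = (2, 1) ∨ x = -(0, 1) ∨ x = -(1, 1) ∨ x = -(2, 1) := by decide
    intro x
    obtain rfl | rfl | rfl | rfl | rfl | rfl | rfl | rfl | rfl := hcases x
    · rw [map_zero, h0]
    · exact g10
    · exact hneg _ g10
    · exact g0
    · exact g1
    · exact g2
    · exact hneg _ g0
    · exact hneg _ g1
    · exact hneg _ g2
  have f02 : c' (0, 2) = n (c' (0, 1)) := hc' (0, 1)
  have f12 : c' (1, 2) = n (c' (2, 1)) := hc' (2, 1)
  have f22 : c' (2, 2) = n (c' (1, 1)) := hc' (1, 1)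
  obtain ⟨e0, e2, e1⟩ | ⟨e0, e2, e1⟩ | ⟨e0, e2, e1⟩ | ⟨e0, e2, e1⟩ | ⟨e0, e2, e1⟩ | ⟨e0, e2, e1⟩ :=
    htri
  · exact hfin (shear 0 1 rfl) rfl e0 e1 e2
  · exact hfin (shear 1 1 rfl) rfl e1 e2 e0
  · exact hfin (shear 2 1 rfl) rfl e2 e0 e1
  -- in the remaining cases the line of height one goes to the opposite line
  all_goals
    rw [e0] at f02
    rw [e1] at f22
    rw [e2] at f12
    rw [hn] at f02 f22 f12
  · exact hfin (shear 1 2 rfl) rfl f12 f22 f02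
  · exact hfin (shear 2 2 rfl) rfl f22 f02 f12
  · exact hfin (shear 0 2 rfl) rfl f02 f12 f22

/-- Let `c` and `c'` be two colourings of the plane over `𝔽₃`, compatible with negation, such that
the pair of colours of the summands in the decompositions `a = u + v` are distributed as those in
`b = u + v`. Then some automorphism carries `a` to `b` and `c` to `c'`. -/
theorem exists_addEquiv_of_colouring {n : ι → ι} (hn : ∀ i, n (n i) = i)
    {c c' : ZMod 3 × ZMod 3 → ι} (hc : ∀ x, c (-x) = n (c x)) (hc' : ∀ x, c' (-x) = n (c' x))
    (h0 : c 0 = c' 0) {a b : ZMod 3 × ZMod 3} (ha : a ≠ 0) (hb : b ≠ 0) (hab : c a = c' b)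
    (H : Finset.univ.val.map (fun u => (c u, c (a - u))) =
      Finset.univ.val.map (fun u => (c' u, c' (b - u)))) :
    ∃ σ : ZMod 3 × ZMod 3 ≃+ ZMod 3 × ZMod 3, σ a = b ∧ ∀ x, c' (σ x) = c x := by
  obtain ⟨e, rfl⟩ := exists_addEquiv_apply_one_zero ha
  obtain ⟨e', rfl⟩ := exists_addEquiv_apply_one_zero hb
  have hmap : ∀ (f : ZMod 3 × ZMod 3 → ι) (g : ZMod 3 × ZMod 3 ≃+ ZMod 3 × ZMod 3),
      Finset.univ.val.map (fun u => (f (g u), f (g ((1, 0) - u)))) =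
        Finset.univ.val.map (fun u => (f u, f (g (1, 0) - u))) := by
    intro f g
    have := congrArg Finset.val (Finset.map_univ_equiv g.toEquiv)
    conv_rhs => rw [← this, Finset.map_val, Multiset.map_map]
    simp
  obtain ⟨σ, hσ, h⟩ := exists_addEquiv_of_colouring_one_zero hn (c := c ∘ e) (c' := c' ∘ e')
    (by simp [hc]) (by simp [hc']) (by simp [h0]) hab ((hmap c e).trans (H.trans (hmap c' e').symm))
  refine ⟨(e.symm.trans σ).trans e', by simp [hσ], fun x => ?_⟩
  simpa using h (e.symm x)

end Plane

/-! ### Automorphisms preserving the basic sets -/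

namespace IsDenseSchurRel

variable {p : ℕ} [Fact p.Prime] {r : Setoid ((ZMod 3 × ZMod 3) × ZMod p)}

/-- The form of `card_slice_eq` used for `exists_addEquiv_of_colouring`: colour `u` by the basic
set of `(u, 1)`, respectively of `(u, k)`. -/
theorem map_slice_eq (hr : IsDenseSchurRel r) (hmul : ∀ k : ZMod p, k ≠ 0 →
      ∀ (a b : ZMod 3 × ZMod 3) (z w : ZMod p), r (a, z) (b, w) → r (a, k * z) (b, k * w))
    {k : ZMod p} {d d' : ZMod 3 × ZMod 3} (h : r (d, 1) (d', k)) :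
    (Finset.univ.val.map fun u => ((⟦(u, 1)⟧, ⟦(d - u, 1)⟧) : Quotient r × Quotient r)) =
      Finset.univ.val.map fun u => ((⟦(u, k)⟧, ⟦(d' - u, k)⟧) : Quotient r × Quotient r) := by
  classical
  -- both multisets have nine elements, so it is enough to compare multiplicities in the first one
  refine Multiset.eq_of_le_of_card_le (Multiset.le_iff_count.2 ?_) (by simp)
  rintro ⟨i, j⟩
  by_cases hij : (i, j) ∈
    (Finset.univ.val.map fun u => ((⟦(u, 1)⟧, ⟦(d - u, 1)⟧) : Quotient r × Quotient r))
  · obtain ⟨a, -, ha⟩ := Multiset.mem_map.1 hij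
    obtain ⟨rfl, rfl⟩ := Prod.mk.inj ha
    have hcount : ∀ (m : ZMod p) (e : ZMod 3 × ZMod 3), Multiset.count (⟦(a, 1)⟧, ⟦(d - a, 1)⟧)
        (Finset.univ.val.map fun u => ((⟦(u, m)⟧, ⟦(e - u, m)⟧) : Quotient r × Quotient r)) =
        Nat.card {u // r (u, m) (a, 1) ∧ r (e - u, m) (d - a, 1)} := by
      intro m e
      rw [Multiset.count_map, Nat.card_eq_fintype_card, Fintype.card_subtype, Finset.card_def,
        Finset.filter_val]
      congr 1
      refine Multiset.filter_congr fun u _ => ?_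
      rw [eq_comm, Prod.mk.injEq, Quotient.eq, Quotient.eq]
    rw [hcount, hcount]
    exact (hr.card_slice_eq hmul h a (d - a)).le
  · rw [Multiset.count_eq_zero_of_notMem hij]
    exact Nat.zero_le _

/-- A relation between a point of height `1` and one of height `k` is realised by `σ × k` for some
automorphism `σ` of the first factor such that `σ × k` preserves all basic sets. -/
theorem exists_addEquiv_of_rel_of_ne_zero (hr : IsDenseSchurRel r) {k : ZMod p}
    {d d' : ZMod 3 × ZMod 3} (h : r (d, 1) (d', k)) (hd : d ≠ 0) :
    ∃ σ : ZMod 3 × ZMod 3 ≃+ ZMod 3 × ZMod 3, σ d = d' ∧ ∀ a z, r (a, z) (σ a, k * z) := by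
  have hmul : ∀ k : ZMod p, k ≠ 0 → ∀ (a b : ZMod 3 × ZMod 3) (z w : ZMod p),
      r (a, z) (b, w) → r (a, k * z) (b, k * w) := fun k hk a b z w =>
    hr.rel_mul_snd (by simp [Nat.card_eq_fintype_card, ZMod.card]) (by decide) hk
  -- negation of the whole group, corrected by the multiplier `-1` on the second factor
  have hneg : ∀ x y : (ZMod 3 × ZMod 3) × ZMod p, r x y → r (-x.1, x.2) (-y.1, y.2) := by
    rintro ⟨a, z⟩ ⟨b, w⟩ hxy
    simpa using hmul (-1) (neg_ne_zero.2 one_ne_zero) _ _ _ _ (hr.neg _ _ hxy)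
  obtain ⟨σ, hσ, hcol⟩ := exists_addEquiv_of_colouring
    (n := Quotient.map (fun x : (ZMod 3 × ZMod 3) × ZMod p => (-x.1, x.2)) hneg)
    (by rintro ⟨x⟩; exact congrArg (Quotient.mk r) (by simp))
    (c := fun u => ⟦(u, 1)⟧) (c' := fun u => ⟦(u, k)⟧) (fun _ => rfl) (fun _ => rfl)
    (Quotient.sound (hr.rel_snd h)) hd (fun hd' => hd ((hr.fst_eq_zero_iff h).2 hd'))
    (Quotient.sound h) (hr.map_slice_eq hmul h)
  refine ⟨σ, hσ, fun a z => ?_⟩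
  have ha : r (a, 1) (σ a, k) := r.symm' (Quotient.exact (hcol a))
  by_cases hz : z = 0
  · simpa [hz] using hr.rel_fst ha
  · simpa [mul_comm] using hmul z hz _ _ _ _ ha

theorem exists_addEquiv_of_rel_one (hr : IsDenseSchurRel r) {k : ZMod p}
    {d d' : ZMod 3 × ZMod 3} (h : r (d, 1) (d', k)) :
    ∃ σ : ZMod 3 × ZMod 3 ≃+ ZMod 3 × ZMod 3, σ d = d' ∧ ∀ a z, r (a, z) (σ a, k * z) := by
  by_cases hd : d = 0
  · obtain rfl : d' = 0 := (hr.fst_eq_zero_iff h).1 hd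
    subst hd
    -- any nonzero point over height `1` is related to some point over height `k`
    obtain ⟨b, hb⟩ := hr.exists_rel_of_rel_snd (1, 0) h
    obtain ⟨σ, -, hσ⟩ := hr.exists_addEquiv_of_rel_of_ne_zero hb (by decide)
    exact ⟨σ, map_zero σ, hσ⟩
  · exact hr.exists_addEquiv_of_rel_of_ne_zero h hd

/-- Related elements are conjugate under an automorphism that preserves all basic sets. -/
theorem exists_addAut_of_rel (hr : IsDenseSchurRel r)
    {x y : (ZMod 3 × ZMod 3) × ZMod p} (h : r x y) :
    ∃ e : (ZMod 3 × ZMod 3) × ZMod p ≃+ (ZMod 3 × ZMod 3) × ZMod p,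
      e x = y ∧ ∀ u, r u (e u) := by
  obtain ⟨a, z⟩ := x
  obtain ⟨b, w⟩ := y
  obtain ⟨k, hk, h1⟩ : ∃ k : ZMod p, k * z = w ∧ r (a, 1) (b, k) := by
    by_cases hz : z = 0
    · obtain rfl : w = 0 := (hr.snd_eq_zero_iff h).1 hz
      subst hz
      -- on the first factor `k` may be any height reached by the basic set of `(a, 1)` over `b`
      obtain ⟨k, hk⟩ := hr.exists_rel_of_rel_fst 1 h
      exact ⟨k, mul_zero k, hk⟩
    · refine ⟨z⁻¹ * w, by field_simp, ?_⟩
      simpa [hz] using hr.rel_mul_snd (by simp [Nat.card_eq_fintype_card, ZMod.card]) (by decide)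
        (inv_ne_zero hz) h
  have hk0 : k ≠ 0 := fun hk0 => one_ne_zero ((hr.snd_eq_zero_iff h1).2 hk0)
  obtain ⟨σ, hσ, hrel⟩ := hr.exists_addEquiv_of_rel_one h1
  refine ⟨σ.prodCongr (AddAut.mulLeft (Units.mk0 k hk0)), ?_, fun u => hrel u.1 u.2⟩
  exact Prod.ext hσ hk

end IsDenseSchurRel

/-! ### Transfer to Schur rings -/

theorem exists_addEquiv_of_card_eq_nine {A : Type*} [CommGroup A] [Finite A]
    (hA : Nat.card A = 9) (hA3 : ∀ a : A, a ^ 3 = 1) :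
    Nonempty (Additive A ≃+ ZMod 3 × ZMod 3) := by
  let _ : Module (ZMod 3) (Additive A) := AddCommGroup.zmodModule fun a => hA3 a.toMul
  have h1 := Module.natCard_eq_pow_finrank (K := ZMod 3) (V := Additive A)
  have h2 : Nat.card (Additive A) = 9 := hA
  rw [h2, Nat.card_zmod, show 9 = 3 ^ 2 by norm_num] at h1
  have h3 : Module.finrank (ZMod 3) (Additive A) = 2 :=
    (Nat.pow_right_injective (by norm_num : 2 ≤ 3) h1).symm
  exact ⟨(LinearEquiv.ofFinrankEq _ _ (by rw [h3]; simp)).toAddEquiv⟩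

namespace SchurRing

/-- The basic-set relation of a Schur ring, read through an additive description of the group. -/
theorem isSchurRel_comap {G W : Type*} [CommGroup G] [Finite G] [AddCommGroup W]
    (𝒜 : SchurRing G) (θ : Multiplicative W ≃* G) :
    IsSchurRel (𝒜.rel.comap fun w => θ (Multiplicative.ofAdd w)) where
  eq_zero x h := by
    have : 𝒜.rel 1 (θ (Multiplicative.ofAdd x)) := by
      simpa [Setoid.comap_rel] using h
    simpa using 𝒜.eq_one_of_rel_one this
  neg x y h := by
    have := 𝒜.rel_inv h
    simp only [← map_inv, ← ofAdd_neg] at this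
    exact this
  card_eq S T hS hT d d' h := by
    let φ : W ≃ G := Multiplicative.ofAdd.trans θ.toEquiv
    have hsat : ∀ U : Set W, IsSaturated (𝒜.rel.comap φ) U → IsSaturated 𝒜.rel (φ.symm ⁻¹' U) :=
      fun U hU x y hxy => hU _ _ (by simpa [Setoid.comap_rel] using hxy)
    have hφ : ∀ e u : W, φ.symm ((φ u)⁻¹ * φ e) = e - u := fun e u => by
      rw [Equiv.symm_apply_eq]
      change (θ (Multiplicative.ofAdd u))⁻¹ * θ (Multiplicative.ofAdd e) =
        θ (Multiplicative.ofAdd (e - u))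
      rw [← map_inv, ← map_mul, ← ofAdd_neg, ← ofAdd_add, neg_add_eq_sub]
    have hcount : ∀ e : W, Nat.card {u : W // u ∈ S ∧ e - u ∈ T} =
        Nat.card {u : G // u ∈ φ.symm ⁻¹' S ∧ u⁻¹ * φ e ∈ φ.symm ⁻¹' T} := fun e =>
      Nat.card_congr (φ.subtypeEquiv fun u => by
        rw [Set.mem_preimage, Set.mem_preimage, hφ, Equiv.symm_apply_apply])
    have hc := 𝒜.coeff_eq_of_mem_ring (𝒜.ring.mul_mem (𝒜.setSum_mem_ring (hsat S hS))
      (𝒜.setSum_mem_ring (hsat T hT))) h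
    rw [coeff_setSum_mul_setSum, coeff_setSum_mul_setSum] at hc
    rw [hcount, hcount]
    exact_mod_cast hc
  of_prime_nsmul q hq hqW x y h := by
    refine 𝒜.rel_of_rel_pow_prime hq ?_ ?_
    · rwa [← Nat.card_congr θ.toEquiv]
    · simp only [← map_pow, ← ofAdd_nsmul]
      exact h

/-- It is enough to connect related elements by automorphisms fixing every basic set; the group of
all such automorphisms then witnesses that the Schur ring is cyclotomic. -/
theorem isCyclotomic_of_forall_rel {G : Type*} [Group G] [Finite G] (𝒜 : SchurRing G)
    (h : ∀ x y, 𝒜.rel x y → ∃ μ : MulAut G, μ x = y ∧ ∀ g, 𝒜.rel g (μ g)) : 𝒜.IsCyclotomic := by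
  let M : Subgroup (MulAut G) :=
    { carrier := {μ | ∀ g, 𝒜.rel g (μ g)}
      one_mem' := fun g => 𝒜.rel.refl' g
      mul_mem' := fun {μ ν} hμ hν g => 𝒜.rel.trans' (hν g) (hμ (ν g))
      inv_mem' := fun {μ} hμ g => by
        have := 𝒜.rel.symm' (hμ (μ⁻¹ g))
        rwa [MulAut.apply_inv_self] at this }
  have horb : ∀ g : G, MulAction.orbit M g = {y | 𝒜.rel y g} := by
    intro g
    ext y
    constructor
    · rintro ⟨⟨μ, hμ⟩, rfl⟩
      exact 𝒜.rel.symm' (hμ g)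
    · intro hy
      obtain ⟨μ, h1, h2⟩ := h g y (𝒜.rel.symm' hy)
      exact ⟨⟨μ, h2⟩, h1⟩
  refine ⟨M, Set.ext fun X => ⟨fun hX => ?_, ?_⟩⟩
  · obtain ⟨x, hx⟩ : X.Nonempty := Set.nonempty_iff_ne_empty.2 fun h0 =>
      𝒜.isPartition.1 (h0 ▸ hX)
    exact ⟨x, (horb x).trans (𝒜.eq_setOf_rel hX hx).symm⟩
  · rintro ⟨g, rfl⟩
    simp only [horb]
    exact 𝒜.setOf_rel_mem_basicSets g

end SchurRing

/-- Every dense Schur ring over `E₉ × C_p`, `p` prime, is cyclotomic. Here `A` is an elementary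
abelian group of order `9` and `P` is a cyclic group of prime order `p`. -/
theorem mainTheorem4 {A P : Type*} [CommGroup A] [CommGroup P] [Finite A] [Finite P]
    (p : ℕ) (hp : p.Prime)
    (hA : Nat.card A = 9) (hA3 : ∀ a : A, a ^ 3 = 1)
    (hP : Nat.card P = p) (hPc : IsCyclic P)
    (𝒜 : SchurRing (A × P)) (h𝒜 : 𝒜.IsDense) :
    𝒜.IsCyclotomic := by
  have : Fact p.Prime := ⟨hp⟩
  obtain ⟨eA⟩ := exists_addEquiv_of_card_eq_nine hA hA3
  subst hP
  let eP := zmodCyclicMulEquiv hPc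
  let θ : Multiplicative ((ZMod 3 × ZMod 3) × ZMod (Nat.card P)) ≃* A × P :=
    (MulEquiv.prodMultiplicative _ _).trans
      ((AddEquiv.toMultiplicativeLeft eA.symm).prodCongr eP)
  have hθ : ∀ a z, θ (Multiplicative.ofAdd (a, z)) =
      ((eA.symm a).toMul, eP (Multiplicative.ofAdd z)) := fun _ _ => rfl
  have hr : IsDenseSchurRel (𝒜.rel.comap fun w => θ (Multiplicative.ofAdd w)) :=
    { 𝒜.isSchurRel_comap θ with
      left := by
        rintro ⟨a, z⟩ ⟨b, w⟩ h
        simpa [hθ, Subgroup.mem_prod] using h𝒜.1.isSaturated _ _ h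
      right := by
        rintro ⟨a, z⟩ ⟨b, w⟩ h
        simpa [hθ, Subgroup.mem_prod] using h𝒜.2.isSaturated _ _ h }
  refine 𝒜.isCyclotomic_of_forall_rel fun x y hxy => ?_
  obtain ⟨x, rfl⟩ := θ.surjective x
  obtain ⟨y, rfl⟩ := θ.surjective y
  obtain ⟨e, h1, h2⟩ := hr.exists_addAut_of_rel (x := x.toAdd) (y := y.toAdd) hxy
  refine ⟨(θ.symm.trans (AddEquiv.toMultiplicative e)).trans θ, ?_, fun g => ?_⟩
  · simp [h1]
  · have := h2 (θ.symm g).toAdd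
    simpa [Setoid.comap_rel] using this
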